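/- Consider a system with $m_1$ synchronous generators (SGs) and $n_1\ge 1$ class-B grid-forming converters (GFCs), with SG inertia constants $H_{gi}>0$, SG inverse governor droops $d_{pgi}$ with $d_{pgT}=\sum_{i=1}^{m_1} d_{pgi}>0$, a common turbine time constant $\tau_{gT}>0$, and GFC droop coefficients $d_{pci}>0$ and power headrooms $\underline P_{ci}^{\max}>0$. Let $H_T=\sum_{i=1}^{m_1} H_{gi}$. The reduced model in center-of-inertia coordinates, with state $z_1=(\omega,P)\in\mathbb R^2$ (the deviations of the center-of-inertia frequency and of the total turbine power from their references) and input $w_1\in\mathbb R$ (minus the deviation of the total load), is $$\dot\omega=\frac1{2H_T}\Big[P-\sum_{i=1}^{n_1}\mathrm{sat}\big(d_{pci}\,\omega,\underline P_{ci}^{\max}\big)+w_1\Big],\qquad \dot P=\frac1{\tau_{gT}}\big[-P-d_{pgT}\,\omega\big],$$ where $\mathrm{sat}(x,L)$ is either the hard saturation $\max(-L,\min(L,x))$ or the smooth saturation $L\tanh(x/L)$. For $\omega\in\mathbb R$, call GFC $k$ minimizing at $\omega$ if it minimizes $\underline P_{ci}^{\max}\tanh\big|\tfrac{d_{pci}}{\underline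 P_{ci}^{\max}}\omega\big|$ over $i=1,\dots,n_1$. For $0<\theta<1$ put $a_\theta=\theta\, n_1\min_i\underline P_{ci}^{\max}$. Then there is a constant $c>0$, not depending on $\theta$, such that for every $\theta\in(0,1)$ the system is input-to-state stable for inputs of magnitude less than $a_\theta$, in the following sense. There is a function $\chi_1$ such that for every $s\in[0,a_\theta)$ $$\chi_1(s)=\frac{\underline P_{c}^{\max}}{d_{pc}}\tanh^{-1}\!\Big(\frac{s}{\theta n_1\underline P_c^{\max}}\Big),$$ where $\underline P_c^{\max}=\underline P_{ck}^{\max}$ and $d_{pc}=d_{pck}$ for some GFC $k$ that is minimizing at $\omega=\chi_1(s)$ (if one GFC is minimizing at every $\omega$, the parameters may be taken to be those of that GFC for all $s$). With $$\chi_2(s)=\Big[\frac{s\,d_{pgT}}{\theta}\chi_1(s)\Big]^{1/2},\qquad \gamma(s)=c\max\{\chi_1(s),\chi_2(s)\},$$ the function $\gamma$ is of class $\mathcal K$ on $[0,a_\theta)$, and there is a class $\mathcal{KL}$ function $\beta$ such that for every initial time $t_0$, every bounded piecewise continuous input $w_1$ on $[t_0,\infty)$ with $\sup_{\tau\ge t_0}|w_1(\tau)|<a_\theta$,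 and every initial state, a solution $z_1$ exists on $[t_0,\infty)$, and every solution $z_1$ satisfies $$\|z_1(t)\|\le\beta\big(\|z_1(t_0)\|,t-t_0\big)+\gamma\Big(\sup_{\tau\ge t_0}|w_1(\tau)|\Big)\qquad\text{for all }t\ge t_0,$$ where $\|\cdot\|$ is the Euclidean norm. -/

import Mathlib

open Set Filter Topology

noncomputable section

namespace COI

/-- Hard (clipping) saturation of the signal `x` at the level `L`. -/
def hardSat (x L : ℝ) : ℝ := max (-L) (min L x)

/-- Smooth saturation of the signal `x` at the level `L`, with unit slope at the origin. -/
def smoothSat (x L : ℝ) : ℝ := L * Real.tanh (x / L)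

/-- Parameters of a system with `m` synchronous generators (SGs) and `n` class-B grid-forming
converters (GFCs). The turbine time constant is common to all SGs. -/
structure System (m n : ℕ) where
  /-- inertia constants of the SGs -/
  Hg : Fin m → ℝ
  /-- inverse governor droops of the SGs -/
  dpg : Fin m → ℝ
  /-- common turbine time constant of the SGs -/
  τgT : ℝ
  /-- droop coefficients of the GFCs -/
  dpc : Fin n → ℝ
  /-- power headrooms of the GFCs -/
  Pmax : Fin n → ℝ

variable {m n : ℕ}

/-- Total inertia. -/
def System.HT (S : System m n) : ℝ := ∑ i, S.Hg i

/-- Total inverse governor droop. -/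
def System.dpgT (S : System m n) : ℝ := ∑ i, S.dpg i

/-- The right-hand side of the reduced model in center-of-inertia coordinates. The state `z` is
`(ω_COI - ω^*, P_τgT - P_gT^*)`, the input `w` is minus the deviation of the total load. -/
def System.field (S : System m n) (sat : ℝ → ℝ → ℝ)
    (z : EuclideanSpace ℝ (Fin 2)) (w : ℝ) : EuclideanSpace ℝ (Fin 2) :=
  !₂[1 / (2 * S.HT) * (z 1 - ∑ i, sat (S.dpc i * z 0) (S.Pmax i) + w),
     1 / S.τgT * (-z 1 - S.dpgT * z 0)]

/-- GFC `k` attains the minimum over all GFCs `i` of `Pmax i * tanh |dpc i / Pmax i * ω|`. -/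
def System.IsMinimizing (S : System m n) (ω : ℝ) (k : Fin n) : Prop :=
  ∀ i, S.Pmax k * Real.tanh |S.dpc k / S.Pmax k * ω|
    ≤ S.Pmax i * Real.tanh |S.dpc i / S.Pmax i * ω|

/-- The (open) bound on the input magnitude: `θ n` times the smallest headroom. -/
def System.inputBound (S : System m n) (θ : ℝ) : ℝ := θ * n * ⨅ i, S.Pmax i

/-- `χ₁ s = (Pmax k / dpc k) artanh (s / (θ n Pmax k))` for every admissible input magnitude `s`,
where `k` is a minimizing GFC at the frequency deviation `χ₁ s`. -/
def System.IsChiOne (S : System m n) (θ : ℝ) (χ₁ : ℝ → ℝ) : Prop :=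
  ∀ s ∈ Ico 0 (S.inputBound θ), ∃ k, S.IsMinimizing (χ₁ s) k ∧
    χ₁ s = S.Pmax k / S.dpc k * Real.artanh (s / (θ * n * S.Pmax k))

/-- The gain `χ₂` built from `χ₁`. -/
def System.chiTwo (S : System m n) (θ : ℝ) (χ₁ : ℝ → ℝ) (s : ℝ) : ℝ :=
  √(s * S.dpgT / θ * χ₁ s)

/-- Class `K` functions on `[0, a)`. -/
def IsClassK (a : ℝ) (γ : ℝ → ℝ) : Prop :=
  ContinuousOn γ (Ico 0 a) ∧ StrictMonoOn γ (Ico 0 a) ∧ γ 0 = 0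

/-- Class `KL` functions on `[0, ∞) × [0, ∞)`. -/
def IsClassKL (β : ℝ → ℝ → ℝ) : Prop :=
  ContinuousOn (Function.uncurry β) (Ici 0 ×ˢ Ici 0) ∧
  (∀ t ∈ Ici (0 : ℝ), StrictMonoOn (fun r => β r t) (Ici 0) ∧ β 0 t = 0) ∧
  (∀ r ∈ Ici (0 : ℝ), AntitoneOn (β r) (Ici 0) ∧ Tendsto (β r) atTop (𝓝 0))

/-- `w` is piecewise continuous on `[t₀, ∞)`: on each compact interval it has finitely many
discontinuities, and one-sided limits exist everywhere. -/
def PiecewiseContinuousFrom (t₀ : ℝ) (w : ℝ → ℝ) : Prop :=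
  (∀ b, {t ∈ Icc t₀ b | ¬ ContinuousWithinAt w (Ici t₀) t}.Finite) ∧
  (∀ t, t₀ ≤ t → ∃ l, Tendsto w (𝓝[>] t) (𝓝 l)) ∧
  (∀ t, t₀ < t → ∃ l, Tendsto w (𝓝[<] t) (𝓝 l))

section ISS

variable {E : Type*} [NormedAddCommGroup E] [NormedSpace ℝ E]

/-- `z` solves `z' = g(z, w)` on `[t₀, ∞)`: it is continuous there and satisfies the equation
wherever the input is continuous. -/
def IsSolution (g : E → ℝ → E) (t₀ : ℝ) (w : ℝ → ℝ) (z : ℝ → E) : Prop :=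
  ContinuousOn z (Ici t₀) ∧
  ∀ t ∈ Ici t₀, ContinuousWithinAt w (Ici t₀) t →
    HasDerivWithinAt z (g (z t) (w t)) (Ici t₀) t

/-- The supremum of `|w|` on `[t₀, ∞)`. -/
def supAbs (t₀ : ℝ) (w : ℝ → ℝ) : ℝ := sSup ((fun t => |w t|) '' Ici t₀)

/-- Input-to-state stability of `z' = g(z, w)` with functions `β` and `γ`, for inputs of
magnitude below `a`: for every bounded piecewise continuous such input and every initial state,
a solution exists on `[t₀, ∞)`, and every solution satisfies the estimate. -/
def IsISSWith (g : E → ℝ → E) (a : ℝ) (β : ℝ → ℝ → ℝ) (γ : ℝ → ℝ) : Prop :=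
  ∀ (t₀ : ℝ) (w : ℝ → ℝ), PiecewiseContinuousFrom t₀ w →
    BddAbove ((fun t => |w t|) '' Ici t₀) → supAbs t₀ w < a → ∀ z₀ : E,
      (∃ z, IsSolution g t₀ w z ∧ z t₀ = z₀) ∧
      ∀ z, IsSolution g t₀ w z → z t₀ = z₀ →
        ∀ t, t₀ ≤ t → ‖z t‖ ≤ β ‖z t₀‖ (t - t₀) + γ (supAbs t₀ w)

end ISS

end COI

end

/-! The energy `V = H_T d_pgT ω² + (τ_gT / 2) P²` is weighted so that the cross terms in `ω P`
cancel along the flow, leaving `V' = -P² - d_pgT ω (∑ sat - w)` (`hasDerivWithinAt_energy`). Both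
saturations absorb at least as much power as the smooth one, so without input the dissipation is at
least `D = P² + d_pgT |ω| ψ(|ω|)`, where `ψ` is `smoothPower`.

Let `|w| ≤ M`. The function `χ₁` is the maximum of the inverses of `ω ↦ θ n Pmax i tanh (dpc i ω /
Pmax i)`. If `|ω| ≥ χ₁ M`, every GFC supplies at least `M / (θ n)`, so the input term is at most `θ
D`. If `|ω| ≤ χ₁ M` but `P² ≥ χ₂(M)²`, the input term is at most `θ P²`. In both cases `V' ≤ -(1 -
θ) D` (`energy_rate_le`). One of the cases holds as soon as `‖z‖² > 2 max(χ₁ M, χ₂ M)²`. Passing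
between `V` and the norm costs a factor that depends only on the weights of `V`, which is why `c`
does not depend on `θ`.

Because of saturation `ψ` is bounded, so `D` need not dominate a fixed multiple of `V`. From `tanh y
≥ y / (1 + y)` it dominates `k / (1 + r) * V` on a region of size proportional to `r`
(`exists_mul_energy_le_dissipation`). With `r` the initial norm,
`le_max_mul_exp_of_hasDerivWithinAt` then gives exponential decay at a rate depending on `r`, down
to the level fixed by `M`; this is the `KL` estimate. Existence of solutions is a global Picard
argument, as the field is Lipschitz in the state and affine in the input. -/

namespace Real

/-! ### Bounds for the hyperbolic tangent and its inverse. -/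

theorem hasDerivAt_tanh_one_div_cosh_sq (x : ℝ) : HasDerivAt tanh (1 / cosh x ^ 2) x := by
  have h := (hasDerivAt_sinh x).div (hasDerivAt_cosh x) (cosh_pos x).ne'
  have e : tanh = sinh / cosh := by
    ext y; simp [tanh_eq_sinh_div_cosh]
  rw [e]
  have e' : (1 : ℝ) = cosh x * cosh x - sinh x * sinh x := by
    linarith [cosh_sq_sub_sinh_sq x, sq (cosh x), sq (sinh x)]
  rw [e']
  exact h

theorem lipschitzWith_one_tanh : LipschitzWith 1 tanh := by
  refine lipschitzWith_of_nnnorm_deriv_le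
    (fun x => (hasDerivAt_tanh_one_div_cosh_sq x).differentiableAt) fun x => ?_
  rw [(hasDerivAt_tanh_one_div_cosh_sq x).deriv, ← NNReal.coe_le_coe, coe_nnnorm, norm_eq_abs,
    abs_of_nonneg (by positivity), NNReal.coe_one, div_le_one (by have := cosh_pos x; positivity)]
  nlinarith [one_le_cosh x]

theorem strictMono_tanh : StrictMono tanh :=
  strictMono_of_deriv_pos fun x => by
    rw [(hasDerivAt_tanh_one_div_cosh_sq x).deriv]
    have := cosh_pos x
    positivity

theorem tanh_nonneg {x : ℝ} (hx : 0 ≤ x) : 0 ≤ tanh x := by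
  simpa using strictMono_tanh.monotone hx

theorem tanh_le_self {x : ℝ} (hx : 0 ≤ x) : tanh x ≤ x := by
  have h := lipschitzWith_one_tanh.dist_le_mul x 0
  simp only [tanh_zero, dist_zero_right, norm_eq_abs, NNReal.coe_one, one_mul] at h
  rw [abs_of_nonneg hx] at h
  exact (le_abs_self _).trans h

/-- After clearing denominators this is `1 + 2x ≤ exp (2x)`. It makes the decay rate explicit
despite saturation. -/
theorem div_one_add_le_tanh {x : ℝ} (hx : 0 ≤ x) : x / (1 + x) ≤ tanh x := by
  have h1 : exp x * exp (-x) = 1 := by rw [← exp_add]; simp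
  have h2 : 2 * x + 1 ≤ exp x * exp x := by
    rw [← exp_add]; linarith [add_one_le_exp (x + x)]
  have h4 := exp_pos (-x)
  have h5 := exp_pos x
  rw [tanh_eq, div_le_div_iff₀ (by positivity) (by positivity)]
  nlinarith [mul_le_mul_of_nonneg_right h2 h4.le, mul_assoc (exp x) (exp x) (exp (-x))]

theorem abs_mul_tanh_abs (x : ℝ) : |x| * tanh |x| = x * tanh x := by
  rcases abs_cases x with ⟨h, _⟩ | ⟨h, _⟩ <;> simp [h]

theorem continuousOn_artanh : ContinuousOn artanh (Ioo (-1) 1) := by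
  unfold artanh
  have hpos : ∀ x ∈ Ioo (-1 : ℝ) 1, 0 < (1 + x) / (1 - x) := fun x hx =>
    div_pos (by linarith [hx.1]) (by linarith [hx.2])
  refine ContinuousOn.log (ContinuousOn.sqrt ?_) fun x hx => (sqrt_pos_of_pos (hpos x hx)).ne'
  exact ContinuousOn.div (by fun_prop) (by fun_prop) fun x hx => by linarith [hx.2]

end Real

/-! ### Sector bounds for the saturations. -/

namespace COI

theorem lipschitzWith_hardSat (L : ℝ) : LipschitzWith 1 fun x => hardSat x L :=
  (LipschitzWith.id.const_min L).const_max (-L)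

theorem lipschitzWith_smoothSat {L : ℝ} (hL : 0 < L) : LipschitzWith 1 fun x => smoothSat x L := by
  refine LipschitzWith.of_dist_le_mul fun x y => ?_
  have h := Real.lipschitzWith_one_tanh.dist_le_mul (x / L) (y / L)
  simp only [NNReal.coe_one, one_mul, Real.dist_eq, smoothSat] at h ⊢
  rw [← sub_div, abs_div, abs_of_pos hL, le_div_iff₀ hL] at h
  rwa [← mul_sub, abs_mul, abs_of_pos hL, mul_comm]

theorem abs_mul_tanh_le_mul_smoothSat {L : ℝ} (hL : 0 < L) (x : ℝ) :
    |x| * (L * Real.tanh (|x| / L)) ≤ x * smoothSat x L := by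
  have h := Real.abs_mul_tanh_abs (x / L)
  rw [abs_div, abs_of_pos hL] at h
  have e : ∀ a b : ℝ, a * (L * b) = L ^ 2 * (a / L * b) := fun a b => by field_simp
  rw [smoothSat, e, e, h]

/-- Since `tanh y ≤ 1` and `tanh y ≤ y` for `y ≥ 0`, the smooth saturation lies below the clipped
one `min L |x|`. -/
theorem abs_mul_tanh_le_mul_hardSat {L : ℝ} (hL : 0 < L) (x : ℝ) :
    |x| * (L * Real.tanh (|x| / L)) ≤ x * hardSat x L := by
  have h : L * Real.tanh (|x| / L) ≤ min L |x| := by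
    refine le_min ?_ ?_
    · nlinarith [Real.tanh_lt_one (|x| / L)]
    · calc L * Real.tanh (|x| / L) ≤ L * (|x| / L) :=
            mul_le_mul_of_nonneg_left (Real.tanh_le_self (by positivity)) hL.le
        _ = |x| := by field_simp
  refine (mul_le_mul_of_nonneg_left h (abs_nonneg x)).trans (le_of_eq ?_)
  unfold hardSat
  rcases abs_cases x with ⟨hx, h0⟩ | ⟨hx, h0⟩
  · rw [hx, max_eq_right]
    exact le_min (by linarith) (by linarith)
  · rw [hx, min_eq_right (by linarith : x ≤ L), max_comm, ← neg_neg x, max_neg_neg, min_comm L]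
    simp

/-- Both saturations are Lipschitz and dominate the smooth one in the sector sense. -/
theorem sat_bounds {sat : ℝ → ℝ → ℝ} (hsat : sat = hardSat ∨ sat = smoothSat) {L : ℝ}
    (hL : 0 < L) : (LipschitzWith 1 fun x => sat x L) ∧
      ∀ x, |x| * (L * Real.tanh (|x| / L)) ≤ x * sat x L := by
  rcases hsat with rfl | rfl
  · exact ⟨lipschitzWith_hardSat L, abs_mul_tanh_le_mul_hardSat hL⟩
  · exact ⟨lipschitzWith_smoothSat hL, abs_mul_tanh_le_mul_smoothSat hL⟩

end COI

/-! ### Global Picard iteration. -/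

open BoundedContinuousFunction in
/-- Global solvability of `x t = x₀ + h t + ∫₀ᵗ G (x s) ds` for a Lipschitz `G` and a
continuous `h` of linear growth. -/
theorem exists_continuous_eq_add_integral {E : Type*} [NormedAddCommGroup E] [NormedSpace ℝ E]
    [CompleteSpace E] {G : E → E} {K : NNReal} (hG : LipschitzWith K G) {h : ℝ → E}
    (hh : Continuous h) {C : ℝ} (hC : 0 ≤ C) (hhC : ∀ t, 0 ≤ t → ‖h t‖ ≤ C * t) (x₀ : E) :
    ∃ x : ℝ → E, Continuous x ∧
      ∀ t, 0 ≤ t → x t = x₀ + h t + ∫ s in (0 : ℝ)..t, G (x s) := by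
  -- Weight of the norm `sup exp (-l t) ‖x t‖`: any `l > K` turns the Picard map into a contraction
  -- on the whole half-line, with ratio `K / l`.
  set l : ℝ := K + 1 with hl
  have hl1 : 1 ≤ l := by rw [hl]; linarith [K.coe_nonneg]
  have hl0 : 0 < l := by linarith
  have hcont : ∀ y : ℝ →ᵇ E, Continuous fun s => G (Real.exp (l * s) • y s) := fun y =>
    hG.continuous.comp (by fun_prop)
  have hexp : ∀ t : ℝ, ∫ s in (0 : ℝ)..t, Real.exp (l * s) = (Real.exp (l * t) - 1) / l := by
    intro t
    rw [intervalIntegral.integral_comp_mul_left (fun s => Real.exp s) hl0.ne', integral_exp]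
    simp [div_eq_inv_mul]
  have hdiff : ∀ (y z : ℝ →ᵇ E) (t : ℝ), 0 ≤ t →
      ‖(∫ s in (0 : ℝ)..t, G (Real.exp (l * s) • y s)) -
        ∫ s in (0 : ℝ)..t, G (Real.exp (l * s) • z s)‖ ≤ K / l * Real.exp (l * t) * dist y z := by
    intro y z t ht
    rw [← intervalIntegral.integral_sub ((hcont y).intervalIntegrable _ _)
      ((hcont z).intervalIntegrable _ _)]
    have hb : ∀ s, ‖G (Real.exp (l * s) • y s) - G (Real.exp (l * s) • z s)‖
        ≤ K * dist y z * Real.exp (l * s) := by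
      intro s
      rw [← dist_eq_norm]
      refine (hG.dist_le_mul _ _).trans ?_
      rw [dist_smul₀, Real.norm_eq_abs, Real.abs_exp]
      have := dist_coe_le_dist (f := y) (g := z) s
      calc (K : ℝ) * (Real.exp (l * s) * dist (y s) (z s))
          ≤ K * (Real.exp (l * s) * dist y z) := by gcongr
        _ = _ := by ring
    refine (intervalIntegral.norm_integral_le_of_norm_le ht (MeasureTheory.ae_of_all _ fun s _ => hb s)
      (Continuous.intervalIntegrable (by fun_prop : Continuous fun s =>
        K * dist y z * Real.exp (l * s)) _ _)).trans ?_
    rw [intervalIntegral.integral_const_mul, hexp]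
    have : (Real.exp (l * t) - 1) / l ≤ Real.exp (l * t) / l := by gcongr; linarith
    calc K * dist y z * ((Real.exp (l * t) - 1) / l)
        ≤ K * dist y z * (Real.exp (l * t) / l) := by gcongr
      _ = _ := by ring
  have hprim : ∀ y : ℝ →ᵇ E, Continuous fun t => ∫ s in (0 : ℝ)..t, G (Real.exp (l * s) • y s) :=
    fun y => intervalIntegral.continuous_primitive
      (fun a b => (hcont y).intervalIntegrable a b) 0
  -- The Picard map in the unknown `y t = exp (-l t) • x t`; `max t 0` extends it constantly to
  -- negative times, so that it acts on functions on all of `ℝ`.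
  set Φ : (ℝ →ᵇ E) → ℝ → E := fun y t => Real.exp (-(l * max t 0)) •
    (x₀ + h (max t 0) + ∫ s in (0 : ℝ)..(max t 0), G (Real.exp (l * s) • y s)) with hΦ
  have hΦc : ∀ y, Continuous (Φ y) := fun y => by
    have h1 : Continuous fun t : ℝ => ∫ s in (0 : ℝ)..(max t 0), G (Real.exp (l * s) • y s) :=
      (hprim y).comp (by fun_prop : Continuous fun t : ℝ => max t 0)
    fun_prop
  have hcancel : ∀ t : ℝ, Real.exp (-(l * t)) * Real.exp (l * t) = 1 := fun t => by
    rw [← Real.exp_add]; simp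
  have hle1 : ∀ t : ℝ, 0 ≤ t → Real.exp (-(l * t)) * t ≤ 1 := fun t ht => by
    rw [← hcancel t]
    gcongr
    nlinarith [Real.add_one_le_exp (l * t)]
  have hle2 : ∀ t : ℝ, 0 ≤ t → Real.exp (-(l * t)) ≤ 1 := fun t ht =>
    Real.exp_le_one_iff.2 (by nlinarith)
  have hdist : ∀ y z t, dist (Φ y t) (Φ z t) ≤ K / l * dist y z := by
    intro y z t
    have ht := le_max_right t 0
    simp only [hΦ]
    rw [dist_smul₀, Real.norm_eq_abs, Real.abs_exp, dist_add_left, dist_eq_norm]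
    calc _ ≤ Real.exp (-(l * max t 0)) * (K / l * Real.exp (l * max t 0) * dist y z) := by
          gcongr; exact hdiff y z _ ht
      _ = (Real.exp (-(l * max t 0)) * Real.exp (l * max t 0)) * (K / l * dist y z) := by ring
      _ = _ := by rw [hcancel, one_mul]
  have hΦ0 : ∀ t, ‖Φ 0 t‖ ≤ ‖x₀‖ + C + ‖G 0‖ := by
    intro t
    have ht := le_max_right t 0
    simp only [hΦ]
    have e : (∫ s in (0 : ℝ)..(max t 0), G (Real.exp (l * s) • (0 : ℝ →ᵇ E) s))
        = max t 0 • G 0 := by simp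
    rw [e, norm_smul, Real.norm_eq_abs, Real.abs_exp]
    have h1 : ‖x₀ + h (max t 0) + max t 0 • G 0‖ ≤ ‖x₀‖ + C * max t 0 + max t 0 * ‖G 0‖ := by
      refine (norm_add₃_le).trans ?_
      rw [norm_smul, Real.norm_eq_abs, abs_of_nonneg ht]
      gcongr
      exact hhC _ ht
    calc _ ≤ Real.exp (-(l * max t 0)) * (‖x₀‖ + C * max t 0 + max t 0 * ‖G 0‖) := by gcongr
      _ = Real.exp (-(l * max t 0)) * ‖x₀‖ + (Real.exp (-(l * max t 0)) * max t 0) * C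
          + (Real.exp (-(l * max t 0)) * max t 0) * ‖G 0‖ := by ring
      _ ≤ 1 * ‖x₀‖ + 1 * C + 1 * ‖G 0‖ := by
          gcongr
          exacts [hle2 _ ht, hle1 _ ht, hle1 _ ht]
      _ = _ := by ring
  have hΦb : ∀ y t, ‖Φ y t‖ ≤ ‖x₀‖ + C + ‖G 0‖ + K / l * dist y 0 := fun y t => by
    have := norm_le_norm_add_norm_sub' (Φ y t) (Φ 0 t)
    rw [← dist_eq_norm] at this
    linarith [hΦ0 t, hdist y 0 t]
  set T : (ℝ →ᵇ E) → (ℝ →ᵇ E) := fun y => ofNormedAddCommGroup (Φ y) (hΦc y) _ (hΦb y) with hT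
  have hTc : ContractingWith (K / (K + 1)) T := by
    refine ⟨?_, LipschitzWith.of_dist_le_mul fun y z => ?_⟩
    · rw [div_lt_one (by positivity)]
      exact lt_add_one K
    · refine (dist_le (by positivity)).2 fun t => ?_
      have := hdist y z t
      simpa [hT, hl] using this
  obtain ⟨y, hy⟩ : ∃ y, T y = y := ⟨_, hTc.fixedPoint_isFixedPt⟩
  refine ⟨fun t => Real.exp (l * t) • y t, by fun_prop, fun t ht => ?_⟩
  have h1 : y t = Φ y t := by
    conv_lhs => rw [← hy]
    rfl
  change Real.exp (l * t) • y t = _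
  rw [h1]
  simp only [hΦ, max_eq_left ht, smul_smul]
  rw [mul_comm (Real.exp (l * t)), hcancel, one_smul]

/-! ### Solutions under piecewise continuous inputs. -/

namespace COI

theorem abs_le_supAbs {t₀ : ℝ} {w : ℝ → ℝ} (hb : BddAbove ((fun t => |w t|) '' Ici t₀)) {t : ℝ}
    (ht : t₀ ≤ t) : |w t| ≤ supAbs t₀ w :=
  le_csSup hb (mem_image_of_mem _ ht)

theorem supAbs_nonneg (t₀ : ℝ) (w : ℝ → ℝ) : 0 ≤ supAbs t₀ w :=
  Real.sSup_nonneg fun _ ⟨_, _, h⟩ => h ▸ abs_nonneg _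

/-- The input of a piecewise continuous signal, restarted at time `0` and frozen before, is
locally integrable. -/
theorem PiecewiseContinuousFrom.intervalIntegrable {t₀ : ℝ} {w : ℝ → ℝ}
    (hw : PiecewiseContinuousFrom t₀ w) {M : ℝ} (hM : ∀ t, t₀ ≤ t → |w t| ≤ M) (a b : ℝ) :
    IntervalIntegrable (fun s => w (t₀ + max s 0)) MeasureTheory.volume a b := by
  set u : ℝ → ℝ := fun s => w (t₀ + max s 0) with hu
  set D : Set ℝ := {s | ¬ ContinuousAt u s} with hD
  have hDc : D.Countable := by
    refine (countable_iUnion fun k : ℕ =>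
      ((hw.1 (t₀ + k)).image fun t => t - t₀).countable).mono fun s hs => ?_
    have hs0 : 0 ≤ s := by
      by_contra! hneg
      refine hs (ContinuousAt.congr (continuousAt_const (y := w t₀)) ?_)
      filter_upwards [Iio_mem_nhds hneg] with r hr
      simp [hu, max_eq_right (le_of_lt (mem_Iio.1 hr))]
    obtain ⟨k, hk⟩ := exists_nat_ge s
    refine mem_iUnion.2 ⟨k, t₀ + s, ⟨⟨by linarith, by linarith⟩, fun hc => hs ?_⟩, by simp⟩
    have h1 : ContinuousWithinAt w (Ici t₀) (t₀ + max s 0) := by rwa [max_eq_left hs0]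
    rw [← continuousWithinAt_univ]
    exact h1.comp (t := Ici t₀) (f := fun s : ℝ => t₀ + max s 0) (s := univ)
      (Continuous.continuousWithinAt (by fun_prop)) fun r _ => by simp
  have hmeas : MeasureTheory.AEStronglyMeasurable u MeasureTheory.volume := by
    have h1 : ContinuousOn u Dᶜ := fun s hs => (not_not.1 hs : ContinuousAt u s).continuousWithinAt
    have h2 := h1.aestronglyMeasurable (μ := MeasureTheory.volume) hDc.measurableSet.compl
    have h3 : ∀ᵐ s ∂MeasureTheory.volume, s ∈ Dᶜ :=
      MeasureTheory.compl_mem_ae_iff.2 (hDc.measure_zero _)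
    rwa [MeasureTheory.Measure.restrict_eq_self_of_ae_mem h3] at h2
  refine (intervalIntegrable_const (c := M)).mono_fun' hmeas.restrict
    (MeasureTheory.ae_of_all _ fun s => ?_)
  exact hM _ (by simp)

/-- Solvability of `z' = G z + w b` for a Lipschitz `G` and a bounded piecewise continuous `w`. -/
theorem exists_isSolution {E : Type*} [NormedAddCommGroup E] [NormedSpace ℝ E] [CompleteSpace E]
    {G : E → E} {K : NNReal} (hG : LipschitzWith K G) (b : E) {t₀ : ℝ} {w : ℝ → ℝ}
    (hw : PiecewiseContinuousFrom t₀ w) {M : ℝ} (hM : ∀ t, t₀ ≤ t → |w t| ≤ M) (z₀ : E) :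
    ∃ z, IsSolution (fun z w => G z + w • b) t₀ w z ∧ z t₀ = z₀ := by
  set u : ℝ → ℝ := fun s => w (t₀ + max s 0) with hu
  have hint := hw.intervalIntegrable hM
  have hM0 : 0 ≤ M := (abs_nonneg _).trans (hM t₀ le_rfl)
  have hcu : Continuous fun t => ∫ s in (0 : ℝ)..t, u s :=
    intervalIntegral.continuous_primitive hint 0
  obtain ⟨x, hx, hxe⟩ := exists_continuous_eq_add_integral hG
    (h := fun t => (∫ s in (0 : ℝ)..t, u s) • b) (by fun_prop) (C := M * ‖b‖) (by positivity)
    (fun t ht => by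
      have h1 := intervalIntegral.norm_integral_le_of_norm_le_const (a := 0) (b := t) (f := u)
        (C := M) fun s _ => hM _ (by simp)
      rw [sub_zero, abs_of_nonneg ht] at h1
      rw [norm_smul]
      calc _ ≤ M * t * ‖b‖ := by gcongr
        _ = _ := by ring) z₀
  refine ⟨fun t => x (t - t₀), ⟨by fun_prop, fun t ht hc => ?_⟩, by simp [hxe 0 le_rfl]⟩
  have ht' : 0 ≤ t - t₀ := sub_nonneg.2 ht
  have hcont : ContinuousAt u (t - t₀) := by
    have h1 : ContinuousWithinAt w (Ici t₀) (t₀ + max (t - t₀) 0) := by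
      rwa [max_eq_left ht', add_sub_cancel]
    rw [← continuousWithinAt_univ]
    exact h1.comp (t := Ici t₀) (f := fun s : ℝ => t₀ + max s 0) (s := univ)
      (Continuous.continuousWithinAt (by fun_prop)) fun r _ => by simp
  have hmeas : StronglyMeasurableAtFilter u (𝓝 (t - t₀)) :=
    ⟨Ioc (t - t₀ - 1) (t - t₀ + 1), Ioc_mem_nhds (by linarith) (by linarith),
      (hint _ _).aestronglyMeasurable⟩
  have hGx : Continuous fun s => G (x s) := hG.continuous.comp hx
  have hd1 : HasDerivAt (fun t => ∫ s in (0 : ℝ)..t, u s) (u (t - t₀)) (t - t₀) :=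
    intervalIntegral.integral_hasDerivAt_right (hint _ _) hmeas hcont
  have hd2 : HasDerivAt (fun t => ∫ s in (0 : ℝ)..t, G (x s)) (G (x (t - t₀))) (t - t₀) :=
    intervalIntegral.integral_hasDerivAt_right (hGx.intervalIntegrable _ _)
      (hGx.stronglyMeasurableAtFilter _ _) hGx.continuousAt
  have hd3 := (((hd1.smul_const b).const_add z₀).add hd2).comp_sub_const t t₀
  have hut : u (t - t₀) = w t := by simp [hu, max_eq_left ht']
  rw [hut, add_comm (w t • b)] at hd3
  exact hd3.hasDerivWithinAt.congr (fun r hr => hxe _ (sub_nonneg.2 hr)) (hxe _ ht')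

/-- A solution has a right derivative everywhere, given by the right limits of the input. -/
theorem IsSolution.exists_right_input {E : Type*} [NormedAddCommGroup E] [NormedSpace ℝ E]
    {g : E → ℝ → E} (hg : Continuous (Function.uncurry g)) {t₀ : ℝ} {w : ℝ → ℝ} {z : ℝ → E}
    (hz : IsSolution g t₀ w z) (hw : PiecewiseContinuousFrom t₀ w) {M : ℝ}
    (hM : ∀ t, t₀ ≤ t → |w t| ≤ M) {t : ℝ} (ht : t₀ ≤ t) :
    ∃ l, |l| ≤ M ∧ HasDerivWithinAt z (g (z t) l) (Ici t) t := by
  obtain ⟨l, hl⟩ := hw.2.1 t ht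
  have hM' : ∀ᶠ s in 𝓝[>] t, |w s| ≤ M := by
    filter_upwards [self_mem_nhdsWithin] with s hs using hM s (ht.trans (le_of_lt hs))
  refine ⟨l, le_of_tendsto hl.abs hM', ?_⟩
  set D := {r ∈ Icc t₀ (t + 1) | ¬ ContinuousWithinAt w (Ici t₀) r}
  -- Discontinuities of the input are finite in number on `[t₀, t + 1]`, so none lies immediately to
  -- the right of `t`; the right derivative at `t` is then the limit of the derivatives.
  have hev : ∀ᶠ s in 𝓝[>] t, HasDerivAt z (g (z s) (w s)) s := by
    have h1 : (D \ {t})ᶜ ∈ 𝓝[>] t :=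
      mem_nhdsWithin_of_mem_nhds (((hw.1 (t + 1)).subset sdiff_subset).isClosed.isOpen_compl.mem_nhds
        (by simp))
    filter_upwards [h1, Ioo_mem_nhdsGT (lt_add_one t)] with s hs1 hs2
    have hs0 : t₀ < s := ht.trans_lt hs2.1
    refine (hz.2 s hs0.le ?_).hasDerivAt (Ici_mem_nhds hs0)
    by_contra hc
    exact hs1 ⟨⟨⟨hs0.le, hs2.2.le⟩, hc⟩, fun h => hs2.1.ne' h⟩
  have hzt : Tendsto z (𝓝[>] t) (𝓝 (z t)) :=
    (hz.1 t ht).mono fun s hs => ht.trans (le_of_lt hs)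
  refine hasDerivWithinAt_Ici_of_tendsto_deriv (s := {s | HasDerivAt z (g (z s) (w s)) s} ∩ Ioi t)
    (fun s hs => hs.1.differentiableAt.differentiableWithinAt) (hzt.mono_left ?_)
    (inter_mem hev self_mem_nhdsWithin) ?_
  · exact nhdsWithin_mono _ inter_subset_right
  · refine Tendsto.congr' (hev.mono fun s hs => hs.deriv.symm) ?_
    exact (hg.tendsto (z t, l)).comp (hzt.prodMk_nhds hl)

end COI

/-! ### The gain functions. -/

namespace COI
namespace System

variable {m n : ℕ} (S : System m n)

/-- The inverse of `ω ↦ θ n Pmax i tanh (dpc i ω / Pmax i)`. -/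
noncomputable def chiGFC (θ : ℝ) (i : Fin n) (s : ℝ) : ℝ :=
  S.Pmax i / S.dpc i * Real.artanh (s / (θ * n * S.Pmax i))

/-- The largest of the functions `chiGFC`, the inverse of the minimum of the functions
`ω ↦ θ n Pmax i tanh (dpc i ω / Pmax i)`. -/
noncomputable def chiOne (θ : ℝ) (s : ℝ) : ℝ := ⨆ i, S.chiGFC θ i s

variable {S} {θ : ℝ}

theorem arg_mem_Ico (hn : 1 ≤ n) (hP : ∀ i, 0 < S.Pmax i) (hθ : 0 < θ) {s : ℝ}
    (hs : s ∈ Ico 0 (S.inputBound θ)) (i : Fin n) : s / (θ * n * S.Pmax i) ∈ Ico (0 : ℝ) 1 := by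
  have hn' : (0 : ℝ) < n := by exact_mod_cast hn
  have hpos : 0 < θ * n * S.Pmax i := mul_pos (mul_pos hθ hn') (hP i)
  refine ⟨div_nonneg hs.1 hpos.le, (div_lt_one hpos).2 (hs.2.trans_le ?_)⟩
  exact mul_le_mul_of_nonneg_left (ciInf_le (finite_range _).bddBelow i) (by positivity)

theorem arg_mem_Ioo (hn : 1 ≤ n) (hP : ∀ i, 0 < S.Pmax i) (hθ : 0 < θ) {s : ℝ}
    (hs : s ∈ Ico 0 (S.inputBound θ)) (i : Fin n) : s / (θ * n * S.Pmax i) ∈ Ioo (-1 : ℝ) 1 :=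
  ⟨by linarith [(arg_mem_Ico hn hP hθ hs i).1], (arg_mem_Ico hn hP hθ hs i).2⟩

theorem chiGFC_le_chiOne (i : Fin n) (s : ℝ) : S.chiGFC θ i s ≤ S.chiOne θ s :=
  le_ciSup (f := fun i => S.chiGFC θ i s) (finite_range _).bddAbove i

theorem exists_chiOne_eq (hn : 1 ≤ n) (s : ℝ) : ∃ i, S.chiOne θ s = S.chiGFC θ i s := by
  have : Nonempty (Fin n) := ⟨⟨0, hn⟩⟩
  obtain ⟨i, hi⟩ := exists_eq_ciSup_of_finite (f := fun i => S.chiGFC θ i s)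
  exact ⟨i, hi.symm⟩

theorem chiGFC_nonneg (hn : 1 ≤ n) (hP : ∀ i, 0 < S.Pmax i) (hd : ∀ i, 0 < S.dpc i) (hθ : 0 < θ)
    {s : ℝ} (hs : s ∈ Ico 0 (S.inputBound θ)) (i : Fin n) : 0 ≤ S.chiGFC θ i s :=
  mul_nonneg (div_pos (hP i) (hd i)).le (Real.artanh_nonneg (arg_mem_Ico hn hP hθ hs i).1)

theorem chiOne_nonneg (hn : 1 ≤ n) (hP : ∀ i, 0 < S.Pmax i) (hd : ∀ i, 0 < S.dpc i) (hθ : 0 < θ)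
    {s : ℝ} (hs : s ∈ Ico 0 (S.inputBound θ)) : 0 ≤ S.chiOne θ s :=
  (chiGFC_nonneg hn hP hd hθ hs ⟨0, hn⟩).trans (chiGFC_le_chiOne _ _)

theorem mul_tanh_chiGFC (hn : 1 ≤ n) (hP : ∀ i, 0 < S.Pmax i) (hd : ∀ i, 0 < S.dpc i) (hθ : 0 < θ)
    {s : ℝ} (hs : s ∈ Ico 0 (S.inputBound θ)) (i : Fin n) :
    S.Pmax i * Real.tanh (S.dpc i / S.Pmax i * S.chiGFC θ i s) = s / (θ * n) := by
  have hn' : (0 : ℝ) < n := by exact_mod_cast hn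
  have h1 := hP i
  have h2 := hd i
  have e : S.dpc i / S.Pmax i * S.chiGFC θ i s = Real.artanh (s / (θ * n * S.Pmax i)) := by
    unfold chiGFC; field_simp
  rw [e, Real.tanh_artanh (arg_mem_Ioo hn hP hθ hs i)]
  field_simp

/-- Beyond `chiOne`, every GFC contributes at least its share of the input magnitude. -/
theorem div_le_mul_tanh (hn : 1 ≤ n) (hP : ∀ i, 0 < S.Pmax i) (hd : ∀ i, 0 < S.dpc i) (hθ : 0 < θ)
    {s : ℝ} (hs : s ∈ Ico 0 (S.inputBound θ)) {x : ℝ} (hx : S.chiOne θ s ≤ x) (i : Fin n) :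
    s / (θ * n) ≤ S.Pmax i * Real.tanh (S.dpc i / S.Pmax i * x) := by
  rw [← mul_tanh_chiGFC hn hP hd hθ hs i]
  have h1 := hP i
  have h2 := hd i
  refine mul_le_mul_of_nonneg_left (Real.strictMono_tanh.monotone ?_) h1.le
  exact mul_le_mul_of_nonneg_left ((chiGFC_le_chiOne i s).trans hx) (by positivity)

/-- The GFC whose inverse is largest at `s` supplies exactly `s / (θ n)` at the frequency `chiOne θ
s`, while every other GFC supplies at least this. -/
theorem isChiOne_chiOne (hn : 1 ≤ n) (hP : ∀ i, 0 < S.Pmax i) (hd : ∀ i, 0 < S.dpc i)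
    (hθ : 0 < θ) : S.IsChiOne θ (S.chiOne θ) := by
  intro s hs
  obtain ⟨k, hk⟩ := exists_chiOne_eq (S := S) (θ := θ) hn s
  refine ⟨k, fun i => ?_, hk⟩
  have hx := chiOne_nonneg hn hP hd hθ hs
  have habs : ∀ i, |S.dpc i / S.Pmax i * S.chiOne θ s| = S.dpc i / S.Pmax i * S.chiOne θ s :=
    fun i => abs_of_nonneg (mul_nonneg (div_pos (hd i) (hP i)).le hx)
  rw [habs, habs]
  calc _ = s / (θ * n) := by rw [hk, mul_tanh_chiGFC hn hP hd hθ hs k]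
    _ ≤ _ := div_le_mul_tanh hn hP hd hθ hs le_rfl i

theorem strictMonoOn_chiGFC (hn : 1 ≤ n) (hP : ∀ i, 0 < S.Pmax i) (hd : ∀ i, 0 < S.dpc i)
    (hθ : 0 < θ) (i : Fin n) : StrictMonoOn (S.chiGFC θ i) (Ico 0 (S.inputBound θ)) := by
  intro s hs r hr hsr
  have hn' : (0 : ℝ) < n := by exact_mod_cast hn
  refine mul_lt_mul_of_pos_left (Real.strictMonoOn_artanh (arg_mem_Ioo hn hP hθ hs i)
    (arg_mem_Ioo hn hP hθ hr i) ?_) (div_pos (hP i) (hd i))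
  exact div_lt_div_of_pos_right hsr (mul_pos (mul_pos hθ hn') (hP i))

theorem strictMonoOn_chiOne (hn : 1 ≤ n) (hP : ∀ i, 0 < S.Pmax i) (hd : ∀ i, 0 < S.dpc i)
    (hθ : 0 < θ) : StrictMonoOn (S.chiOne θ) (Ico 0 (S.inputBound θ)) := by
  intro s hs r hr hsr
  obtain ⟨k, hk⟩ := exists_chiOne_eq (S := S) (θ := θ) hn s
  rw [hk]
  exact (strictMonoOn_chiGFC hn hP hd hθ k hs hr hsr).trans_le (chiGFC_le_chiOne k r)

theorem continuousOn_chiOne (hn : 1 ≤ n) (hP : ∀ i, 0 < S.Pmax i) (hθ : 0 < θ) :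
    ContinuousOn (S.chiOne θ) (Ico 0 (S.inputBound θ)) := by
  have : Nonempty (Fin n) := ⟨⟨0, hn⟩⟩
  have e : S.chiOne θ = fun s => Finset.univ.sup' Finset.univ_nonempty fun i => S.chiGFC θ i s := by
    ext s
    exact (Finset.sup'_univ_eq_ciSup _).symm
  rw [e]
  refine ContinuousOn.finset_sup'_apply _ fun i _ => ?_
  refine ContinuousOn.mul continuousOn_const (Real.continuousOn_artanh.comp (by fun_prop) ?_)
  exact fun s hs => arg_mem_Ioo hn hP hθ hs i

theorem chiOne_zero (hn : 1 ≤ n) : S.chiOne θ 0 = 0 := by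
  obtain ⟨k, hk⟩ := exists_chiOne_eq (S := S) (θ := θ) hn 0
  rw [hk]
  simp [chiGFC]

theorem isClassK_gain (hn : 1 ≤ n) (hP : ∀ i, 0 < S.Pmax i) (hd : ∀ i, 0 < S.dpc i)
    (hdg : 0 < S.dpgT) (hθ : 0 < θ) {c : ℝ} (hc : 0 < c) :
    IsClassK (S.inputBound θ)
      fun s => c * max (S.chiOne θ s) (S.chiTwo θ (S.chiOne θ) s) := by
  have hcont := continuousOn_chiOne (S := S) hn hP hθ
  have hmono := strictMonoOn_chiOne hn hP hd hθ
  refine ⟨?_, ?_, ?_⟩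
  · refine continuousOn_const.mul (hcont.sup ?_)
    exact ContinuousOn.sqrt (ContinuousOn.mul (by fun_prop) hcont)
  · intro s hs r hr hsr
    refine mul_lt_mul_of_pos_left (max_lt_max (hmono hs hr hsr) ?_) hc
    have h0 := chiOne_nonneg hn hP hd hθ hs
    refine Real.sqrt_lt_sqrt (mul_nonneg (div_nonneg (mul_nonneg hs.1 hdg.le) hθ.le) h0) ?_
    refine mul_lt_mul'' ?_ (hmono hs hr hsr)
      (div_nonneg (mul_nonneg hs.1 hdg.le) hθ.le) h0
    exact div_lt_div_of_pos_right (mul_lt_mul_of_pos_right hsr hdg) hθ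
  · simp [chiOne_zero hn, chiTwo]

end System
end COI

/-! ### A comparison principle for right derivatives. -/

/-- A function that decreases strictly above the level `N`, and at the exponential rate `k` as
long as it does not exceed its initial value, stays below the larger of `N` and the exponential. -/
theorem le_max_mul_exp_of_hasDerivWithinAt {f : ℝ → ℝ} {t₀ k N : ℝ} (hk : 0 ≤ k)
    (hf : ContinuousOn f (Ici t₀)) (hf0 : 0 ≤ f t₀)
    (hf' : ∀ t, t₀ ≤ t → ∃ f', HasDerivWithinAt f f' (Ici t) t ∧
      (N < f t → f' < 0 ∧ (f t ≤ f t₀ → f' < -(k * f t)))) {t : ℝ} (ht : t₀ ≤ t) :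
    f t ≤ max (f t₀ * Real.exp (-(k * (t - t₀)))) N := by
  set U : ℝ → ℝ := fun s => f t₀ * Real.exp (-(k * (s - t₀))) with hU
  have hUd : ∀ s, HasDerivAt U (-(k * U s)) s := fun s => by
    have h1 : HasDerivAt (fun s => -(k * (s - t₀))) (-(k * 1)) s :=
      (((hasDerivAt_id s).sub_const t₀).const_mul k).neg
    have h2 := (h1.exp).const_mul (f t₀)
    have e : f t₀ * (Real.exp (-(k * (s - t₀))) * -(k * 1)) = -(k * U s) := by
      simp only [hU]; ring
    rwa [e] at h2
  have hUc : Continuous U := by fun_prop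
  have hUanti : ∀ r s, r ≤ s → U s ≤ U r := fun r s h => by
    simp only [hU]
    gcongr
  have key : ∀ ε, 0 < ε → f t ≤ max (U t) (N + ε) := by
    intro ε hε
    choose! f' hfd hfb using hf'
    refine image_le_of_deriv_right_lt_deriv_boundary' (f := f) (f' := f') (a := t₀) (b := t)
      (B := fun s => max (U s) (N + ε)) (B' := fun s => if U s ≤ N + ε then 0 else -(k * U s))
      -- The margin `ε` puts `f` strictly above `N` wherever it meets the barrier, so the hypothesis
      -- yields a strict inequality of slopes there.
      (hf.mono Icc_subset_Ici_self) (fun s hs => hfd s hs.1) ?_ (by fun_prop) ?_ ?_ ⟨ht, le_rfl⟩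
    · simp [hU]
    · intro s hs
      split_ifs with h
      · refine (hasDerivWithinAt_const s (Ici s) (N + ε)).congr (fun r hr => ?_) (max_eq_right h)
        exact max_eq_right ((hUanti s r hr).trans h)
      · refine ((hUd s).congr_of_eventuallyEq ?_).hasDerivWithinAt
        filter_upwards [hUc.continuousAt.eventually (lt_mem_nhds (not_le.1 h))] with r hr
        exact max_eq_left hr.le
    · intro s hs he
      have hN : N < f s := by rw [he]; linarith [le_max_right (U s) (N + ε)]
      obtain ⟨h1, h2⟩ := hfb s hs.1 hN
      split_ifs with h
      · exact h1
      · rw [max_eq_left (not_le.1 h).le] at he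
        rw [← he]
        -- On the exponential branch `f s = U s ≤ U t₀ = f t₀`, so the rate is available.
        refine h2 ?_
        rw [he]
        simpa [hU] using hUanti t₀ s hs.1
  refine le_of_forall_pos_le_add fun ε hε => (key ε hε).trans ?_
  exact max_le (by linarith [le_max_left (U t) N]) (by linarith [le_max_right (U t) N])

/-! ### The decay function. -/

namespace COI

theorem isClassKL_mul_exp_div {C k : ℝ} (hC : 0 < C) (hk : 0 < k) :
    IsClassKL fun r t => C * (r * Real.exp (-(k / (1 + r) * t))) := by
  refine ⟨?_, fun t ht => ⟨fun r hr r' hr' hrr' => ?_, by simp⟩, fun r hr => ⟨?_, ?_⟩⟩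
  · have hden : ∀ p ∈ (Ici 0 ×ˢ Ici 0 : Set (ℝ × ℝ)), 1 + p.1 ≠ 0 := fun p hp => by
      have : (0 : ℝ) ≤ p.1 := hp.1
      positivity
    have h1 : ContinuousOn (fun p : ℝ × ℝ => k / (1 + p.1)) (Ici 0 ×ˢ Ici 0) :=
      ContinuousOn.div (by fun_prop) (by fun_prop) hden
    have h2 : ContinuousOn (fun p : ℝ × ℝ => C * (p.1 * Real.exp (-(k / (1 + p.1) * p.2))))
      (Ici 0 ×ˢ Ici 0) := by fun_prop
    exact h2
  · have h0 : (0 : ℝ) ≤ r := hr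
    have h0' : (0 : ℝ) ≤ t := ht
    have h1 : Real.exp (-(k / (1 + r) * t)) ≤ Real.exp (-(k / (1 + r') * t)) := by
      gcongr
    refine mul_lt_mul_of_pos_left ?_ hC
    exact mul_lt_mul hrr' h1 (Real.exp_pos _) (h0.trans hrr'.le)
  · have h0 : (0 : ℝ) ≤ r := hr
    intro t _ t' _ h
    dsimp only
    gcongr
  · have h0 : (0 : ℝ) ≤ r := hr
    have h1 : Tendsto (fun t => -(k / (1 + r) * t)) atTop atBot :=
      tendsto_neg_atTop_atBot.comp (tendsto_id.const_mul_atTop (by positivity))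
    have h2 := (Real.tendsto_exp_atBot.comp h1).const_mul (C * r)
    rw [mul_zero] at h2
    refine h2.congr fun t => ?_
    simp [mul_assoc]

/-! ### Energy and dissipation. -/

namespace System

variable {m n : ℕ} (S : System m n) {sat : ℝ → ℝ → ℝ}

theorem HT_pos (hH : ∀ i, 0 < S.Hg i) (hdg : 0 < S.dpgT) : 0 < S.HT := by
  refine Finset.sum_pos (fun i _ => hH i) ?_
  -- Without any SG the sum `dpgT` would be empty, hence zero.
  by_contra h
  rw [Finset.not_nonempty_iff_eq_empty] at h
  simp [dpgT, h] at hdg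

/-- The total power of the GFCs at the frequency deviation `x`. -/
def gfcPower (sat : ℝ → ℝ → ℝ) (x : ℝ) : ℝ := ∑ i, sat (S.dpc i * x) (S.Pmax i)

/-- The total power of the GFCs with smooth saturations at the frequency deviation `x`. -/
noncomputable def smoothPower (x : ℝ) : ℝ := ∑ i, S.Pmax i * Real.tanh (S.dpc i / S.Pmax i * x)

variable {S}

theorem abs_mul_smoothPower_le (hsat : sat = hardSat ∨ sat = smoothSat)
    (hP : ∀ i, 0 < S.Pmax i) (hd : ∀ i, 0 < S.dpc i) (x : ℝ) :
    |x| * S.smoothPower |x| ≤ x * S.gfcPower sat x := by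
  rw [smoothPower, gfcPower, Finset.mul_sum, Finset.mul_sum]
  refine Finset.sum_le_sum fun i _ => ?_
  have h := (sat_bounds hsat (hP i)).2 (S.dpc i * x)
  rw [abs_mul, abs_of_pos (hd i), mul_assoc, mul_assoc] at h
  rw [div_mul_eq_mul_div]
  exact le_of_mul_le_mul_left h (hd i)

theorem smoothPower_term_nonneg (hP : ∀ i, 0 < S.Pmax i) (hd : ∀ i, 0 < S.dpc i) {x : ℝ}
    (hx : 0 ≤ x) (i : Fin n) : 0 ≤ S.Pmax i * Real.tanh (S.dpc i / S.Pmax i * x) :=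
  mul_nonneg (hP i).le (Real.tanh_nonneg (mul_nonneg (div_pos (hd i) (hP i)).le hx))

theorem smoothPower_nonneg (hP : ∀ i, 0 < S.Pmax i) (hd : ∀ i, 0 < S.dpc i) {x : ℝ}
    (hx : 0 ≤ x) : 0 ≤ S.smoothPower x :=
  Finset.sum_nonneg fun i _ => smoothPower_term_nonneg hP hd hx i

theorem le_mul_smoothPower (hn : 1 ≤ n) (hP : ∀ i, 0 < S.Pmax i) (hd : ∀ i, 0 < S.dpc i) {θ : ℝ}
    (hθ : 0 < θ) {s : ℝ} (hs : s ∈ Ico 0 (S.inputBound θ)) {x : ℝ} (hx : S.chiOne θ s ≤ x) :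
    s ≤ θ * S.smoothPower x := by
  have hn' : (0 : ℝ) < n := by exact_mod_cast hn
  have h := Finset.sum_le_sum fun i (_ : i ∈ Finset.univ) => div_le_mul_tanh hn hP hd hθ hs hx i
  rw [Finset.sum_const, Finset.card_univ, Fintype.card_fin, nsmul_eq_mul] at h
  calc s = θ * (n * (s / (θ * n))) := by field_simp
    _ ≤ _ := mul_le_mul_of_nonneg_left h hθ.le

/-- A single GFC suffices, as all contributions are nonnegative. -/
theorem exists_div_le_smoothPower (hn : 1 ≤ n) (hP : ∀ i, 0 < S.Pmax i) (hd : ∀ i, 0 < S.dpc i) :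
    ∃ a p : ℝ, 0 < a ∧ 0 < p ∧ ∀ x, 0 ≤ x → p * x / (1 + a * x) ≤ S.smoothPower x := by
  set i : Fin n := ⟨0, hn⟩
  have h1 := hP i
  have h2 := hd i
  refine ⟨S.dpc i / S.Pmax i, S.dpc i, by positivity, h2, fun x hx => ?_⟩
  have h3 := Real.div_one_add_le_tanh (x := S.dpc i / S.Pmax i * x) (by positivity)
  calc S.dpc i * x / (1 + S.dpc i / S.Pmax i * x)
      = S.Pmax i * (S.dpc i / S.Pmax i * x / (1 + S.dpc i / S.Pmax i * x)) := by field_simp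
    _ ≤ S.Pmax i * Real.tanh (S.dpc i / S.Pmax i * x) := mul_le_mul_of_nonneg_left h3 h1.le
    _ ≤ _ := Finset.single_le_sum (f := fun i => S.Pmax i * Real.tanh (S.dpc i / S.Pmax i * x))
        (fun i _ => smoothPower_term_nonneg hP hd hx i) (Finset.mem_univ i)

variable (S) in
/-- The stored energy, a quadratic Lyapunov function. -/
noncomputable def energy (z : EuclideanSpace ℝ (Fin 2)) : ℝ :=
  S.HT * S.dpgT * z 0 ^ 2 + S.τgT / 2 * z 1 ^ 2

theorem hasDerivWithinAt_energy (hH : S.HT ≠ 0) (hτ : S.τgT ≠ 0)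
    {z : ℝ → EuclideanSpace ℝ (Fin 2)} {w : ℝ} {s : Set ℝ} {t : ℝ}
    (hz : HasDerivWithinAt z (S.field sat (z t) w) s t) :
    HasDerivWithinAt (fun t => S.energy (z t))
      (-z t 1 ^ 2 - S.dpgT * (z t 0 * S.gfcPower sat (z t 0) - z t 0 * w)) s t := by
  have hc : ∀ i, HasDerivWithinAt (fun t => z t i) (S.field sat (z t) w i) s t := fun i =>
    (EuclideanSpace.proj (𝕜 := ℝ) i).hasFDerivAt.comp_hasDerivWithinAt t hz
  have h := (((hc 0).pow 2).const_mul (S.HT * S.dpgT)).add (((hc 1).pow 2).const_mul (S.τgT / 2))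
  refine h.congr_deriv ?_
  simp [field, gfcPower]
  field_simp
  ring

/-- Dissipation where the state is large compared with the gains at the input magnitude. -/
theorem energy_rate_le (hsat : sat = hardSat ∨ sat = smoothSat) (hn : 1 ≤ n)
    (hP : ∀ i, 0 < S.Pmax i) (hd : ∀ i, 0 < S.dpc i) (hdg : 0 < S.dpgT) {θ : ℝ} (hθ : 0 < θ)
    {M : ℝ} (hM : M ∈ Ico 0 (S.inputBound θ)) {x p w : ℝ} (hw : |w| ≤ M)
    (hxp : S.chiOne θ M ≤ |x| ∨ M * S.dpgT / θ * S.chiOne θ M ≤ p ^ 2) :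
    -p ^ 2 - S.dpgT * (x * S.gfcPower sat x - x * w)
      ≤ -((1 - θ) * (p ^ 2 + S.dpgT * (|x| * S.smoothPower |x|))) := by
  have h1 := abs_mul_smoothPower_le hsat hP hd x
  have h2 : x * w ≤ |x| * M := (le_abs_self _).trans <| by
    rw [abs_mul]; exact mul_le_mul_of_nonneg_left hw (abs_nonneg x)
  have hψ := smoothPower_nonneg hP hd (abs_nonneg x)
  have h3 : S.dpgT * (|x| * S.smoothPower |x| - |x| * M)
      ≤ S.dpgT * (x * S.gfcPower sat x - x * w) :=
    mul_le_mul_of_nonneg_left (by linarith) hdg.le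
  have h4 : 0 ≤ S.dpgT * (|x| * S.smoothPower |x|) := by positivity
  have h5 : S.dpgT * (|x| * M) ≤ θ * (p ^ 2 + S.dpgT * (|x| * S.smoothPower |x|)) := by
    rcases le_total (S.chiOne θ M) |x| with h | h
    · have h6 := le_mul_smoothPower hn hP hd hθ hM h
      have h7 : S.dpgT * (|x| * M) ≤ S.dpgT * (|x| * (θ * S.smoothPower |x|)) := by gcongr
      nlinarith [mul_nonneg hθ.le (sq_nonneg p)]
    · rcases hxp with h' | h'
      · have h6 := le_mul_smoothPower hn hP hd hθ hM h'
        have h7 : S.dpgT * (|x| * M) ≤ S.dpgT * (|x| * (θ * S.smoothPower |x|)) := by gcongr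
        nlinarith [mul_nonneg hθ.le (sq_nonneg p)]
      -- At small frequency deviation the input power is bounded through `χ₁ M` and paid for by the
      -- turbine damping `p ^ 2` alone.
      · have hM0 := hM.1
        have h7 : S.dpgT * (|x| * M) ≤ S.dpgT * (S.chiOne θ M * M) := by gcongr
        have h8 : S.dpgT * (S.chiOne θ M * M) = θ * (M * S.dpgT / θ * S.chiOne θ M) := by
          field_simp
        have h9 := mul_le_mul_of_nonneg_left h' hθ.le
        nlinarith [mul_nonneg hθ.le h4]
  linarith

theorem lipschitzWith_gfcPower (hsat : sat = hardSat ∨ sat = smoothSat)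
    (hP : ∀ i, 0 < S.Pmax i) : ∃ K, LipschitzWith K (S.gfcPower sat) := by
  refine ⟨∑ i, ‖S.dpc i‖₊, LipschitzWith.of_dist_le_mul fun x y => ?_⟩
  refine (dist_sum_sum_le _ _ _).trans ?_
  rw [NNReal.coe_sum, Finset.sum_mul]
  refine Finset.sum_le_sum fun i _ => ?_
  have h := (sat_bounds hsat (hP i)).1.dist_le_mul (S.dpc i * x) (S.dpc i * y)
  rw [NNReal.coe_one, one_mul, Real.dist_eq, Real.dist_eq, ← mul_sub, abs_mul] at h
  exact h

theorem field_eq (z : EuclideanSpace ℝ (Fin 2)) (w : ℝ) :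
    S.field sat z w = S.field sat z 0 + w • !₂[1 / (2 * S.HT), 0] := by
  ext i
  fin_cases i <;> simp [field]
  ring

theorem exists_lipschitzWith_field (hsat : sat = hardSat ∨ sat = smoothSat)
    (hP : ∀ i, 0 < S.Pmax i) : ∃ K, LipschitzWith K fun z => S.field sat z 0 := by
  obtain ⟨K, hK⟩ := lipschitzWith_gfcPower hsat hP
  have hp : ∀ i, LipschitzWith _ fun z : EuclideanSpace ℝ (Fin 2) => z i := fun i =>
    (EuclideanSpace.proj (𝕜 := ℝ) i).lipschitz
  have hs : ∀ v : EuclideanSpace ℝ (Fin 2), LipschitzWith _ fun x : ℝ => x • v := fun v =>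
    (ContinuousLinearMap.toSpanSingleton ℝ v).lipschitz
  have h0 := (hs !₂[1 / (2 * S.HT), 0]).comp ((hp 1).sub (hK.comp (hp 0)))
  have h1 := (hs !₂[0, 1 / S.τgT]).comp
    ((hp 1).neg.sub ((lipschitzWith_smul S.dpgT).comp (hp 0)))
  have e : (fun z => S.field sat z 0) = fun z =>
      (z 1 - S.gfcPower sat (z 0)) • !₂[1 / (2 * S.HT), 0]
        + (-z 1 - S.dpgT * z 0) • !₂[0, 1 / S.τgT] := by
    ext z i
    fin_cases i <;> simp [field, gfcPower, mul_comm]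
  rw [e]
  exact ⟨_, h0.add h1⟩

theorem continuous_field (hsat : sat = hardSat ∨ sat = smoothSat) (hP : ∀ i, 0 < S.Pmax i) :
    Continuous (Function.uncurry (S.field sat)) := by
  obtain ⟨K, hK⟩ := exists_lipschitzWith_field hsat hP
  have e : Function.uncurry (S.field sat)
      = fun q => S.field sat q.1 0 + q.2 • !₂[1 / (2 * S.HT), 0] := by
    ext1 q; exact field_eq _ _
  rw [e]
  have := hK.continuous
  exact (this.comp continuous_fst).add (continuous_snd.smul continuous_const)

end System
end COI

/-! ### Comparison of energy, norm and dissipation. -/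

namespace COI
namespace System

variable {m n : ℕ} {S : System m n} {sat : ℝ → ℝ → ℝ}

theorem energy_bounds {a b : ℝ} (ha : a = min (S.HT * S.dpgT) (S.τgT / 2))
    (hb : b = max (S.HT * S.dpgT) (S.τgT / 2)) (z : EuclideanSpace ℝ (Fin 2)) :
    a * ‖z‖ ^ 2 ≤ S.energy z ∧ S.energy z ≤ b * ‖z‖ ^ 2 := by
  have h1 : ‖z‖ ^ 2 = z 0 ^ 2 + z 1 ^ 2 := by
    rw [EuclideanSpace.real_norm_sq_eq, Fin.sum_univ_two]
  have h2 := sq_nonneg (z 0)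
  have h3 := sq_nonneg (z 1)
  rw [h1, energy, ha, hb]
  constructor
  · nlinarith [mul_le_mul_of_nonneg_right (min_le_left (S.HT * S.dpgT) (S.τgT / 2)) h2,
      mul_le_mul_of_nonneg_right (min_le_right (S.HT * S.dpgT) (S.τgT / 2)) h3]
  · nlinarith [mul_le_mul_of_nonneg_right (le_max_left (S.HT * S.dpgT) (S.τgT / 2)) h2,
      mul_le_mul_of_nonneg_right (le_max_right (S.HT * S.dpgT) (S.τgT / 2)) h3]

/-- Lower bound of the dissipation by the energy, uniform on sublevel sets. -/
theorem exists_mul_energy_le_dissipation (hn : 1 ≤ n) (hP : ∀ i, 0 < S.Pmax i)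
    (hd : ∀ i, 0 < S.dpc i) (hdg : 0 < S.dpgT) (hH : 0 < S.HT) (hτ : 0 < S.τgT) {C : ℝ}
    (hC : 0 ≤ C) : ∃ k, 0 < k ∧ ∀ r, 0 ≤ r → ∀ z : EuclideanSpace ℝ (Fin 2), |z 0| ≤ C * r →
      k / (1 + r) * S.energy z ≤ z 1 ^ 2 + S.dpgT * (|z 0| * S.smoothPower |z 0|) := by
  obtain ⟨a, p, ha, hp, hψ⟩ := exists_div_le_smoothPower hn hP hd
  -- The first entry serves the frequency term, through `1 + a |z 0| ≤ (1 + a C) (1 + r)`; the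
  -- second serves the turbine term.
  refine ⟨min (p / (S.HT * (1 + a * C))) (2 / S.τgT), by positivity, fun r hr z hz => ?_⟩
  set k := min (p / (S.HT * (1 + a * C))) (2 / S.τgT)
  have hk0 : 0 < k := by positivity
  have h1 : k * (S.HT * (1 + a * C)) ≤ p := by
    rw [← le_div_iff₀ (by positivity)]
    exact min_le_left _ _
  have h2 : k * S.τgT ≤ 2 := by
    rw [← le_div_iff₀ hτ]
    exact min_le_right _ _
  set x := |z 0|
  have hx : 0 ≤ x := abs_nonneg _
  have hxz : z 0 ^ 2 = x ^ 2 := (sq_abs _).symm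
  have h3 : k / (1 + r) * (S.τgT / 2 * z 1 ^ 2) ≤ z 1 ^ 2 := by
    rw [div_mul_eq_mul_div, div_le_iff₀ (by positivity)]
    nlinarith [mul_le_mul_of_nonneg_right h2 (sq_nonneg (z 1)), mul_nonneg hr (sq_nonneg (z 1))]
  have h4 : k / (1 + r) * (S.HT * x) ≤ p * x / (1 + a * x) := by
    rw [div_mul_eq_mul_div, div_le_div_iff₀ (by positivity) (by positivity)]
    have h5 : 1 + a * x ≤ (1 + a * C) * (1 + r) := by
      nlinarith [mul_le_mul_of_nonneg_left hz ha.le, mul_nonneg ha.le hC]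
    calc k * (S.HT * x) * (1 + a * x) ≤ k * (S.HT * x) * ((1 + a * C) * (1 + r)) := by gcongr
      _ = (k * (S.HT * (1 + a * C))) * (x * (1 + r)) := by ring
      _ ≤ p * (x * (1 + r)) := by gcongr
      _ = _ := by ring
  have h5 : S.dpgT * (x * (k / (1 + r) * (S.HT * x))) ≤ S.dpgT * (x * S.smoothPower x) := by
    gcongr
    exact h4.trans (hψ x hx)
  calc k / (1 + r) * S.energy z = k / (1 + r) * (S.τgT / 2 * z 1 ^ 2)
        + S.dpgT * (x * (k / (1 + r) * (S.HT * x))) := by rw [energy, hxz]; ring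
    _ ≤ _ := add_le_add h3 h5

end System
end COI

/-! ### Assembly of the stability estimate. -/

theorem mainTheorem7 {m n : ℕ} (S : COI.System m n) (sat : ℝ → ℝ → ℝ)
    (hsat : sat = COI.hardSat ∨ sat = COI.smoothSat)
    (hn : 1 ≤ n) (hHg : ∀ i, 0 < S.Hg i) (hdpgT : 0 < S.dpgT) (hτ : 0 < S.τgT)
    (hdpc : ∀ i, 0 < S.dpc i) (hPmax : ∀ i, 0 < S.Pmax i) :
    ∃ c : ℝ, 0 < c ∧ ∀ θ : ℝ, 0 < θ → θ < 1 →
      ∃ χ₁ : ℝ → ℝ, S.IsChiOne θ χ₁ ∧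
        COI.IsClassK (S.inputBound θ) (fun s => c * max (χ₁ s) (S.chiTwo θ χ₁ s)) ∧
        ∃ β : ℝ → ℝ → ℝ, COI.IsClassKL β ∧
          COI.IsISSWith (S.field sat) (S.inputBound θ) β
            (fun s => c * max (χ₁ s) (S.chiTwo θ χ₁ s)) := by
  have hH := COI.System.HT_pos S hHg hdpgT
  obtain ⟨a, ha⟩ : ∃ a, a = min (S.HT * S.dpgT) (S.τgT / 2) := ⟨_, rfl⟩
  obtain ⟨b, hb⟩ : ∃ b, b = max (S.HT * S.dpgT) (S.τgT / 2) := ⟨_, rfl⟩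
  have ha0 : 0 < a := by rw [ha]; positivity
  have hb0 : 0 < b := by rw [hb]; positivity
  have hV := COI.System.energy_bounds (S := S) ha hb
  obtain ⟨C, hC⟩ : ∃ C, C = √(b / a) := ⟨_, rfl⟩
  have hC0 : 0 < C := by rw [hC]; positivity
  have hCsq : a * C ^ 2 = b := by rw [hC, Real.sq_sqrt (by positivity)]; field_simp
  -- Norms are compared through the energy.
  have hnorm : ∀ (z : EuclideanSpace ℝ (Fin 2)) (q : ℝ), 0 ≤ q → S.energy z ≤ b * q ^ 2 →
      ‖z‖ ≤ C * q := fun z q hq h => by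
    refine abs_le_of_sq_le_sq' ?_ (by positivity) |>.2
    refine le_of_mul_le_mul_left ?_ ha0
    calc a * ‖z‖ ^ 2 ≤ b * q ^ 2 := (hV z).1.trans h
      _ = a * (C * q) ^ 2 := by rw [← hCsq]; ring
  obtain ⟨k, hk0, hk⟩ :=
    COI.System.exists_mul_energy_le_dissipation hn hPmax hdpc hdpgT hH hτ hC0.le
  refine ⟨C * √2, by positivity, fun θ hθ hθ1 => ⟨S.chiOne θ,
    COI.System.isChiOne_chiOne hn hPmax hdpc hθ,
    COI.System.isClassK_gain hn hPmax hdpc hdpgT hθ (by positivity), ?_⟩⟩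
  have hk' : 0 < (1 - θ) * k := mul_pos (by linarith) hk0
  -- Of the factor `1 / 4`, one half buys a strict differential inequality and the other comes from
  -- the square root taken between energy and norm.
  refine ⟨fun r t => C * (r * Real.exp (-((1 - θ) * k / 4 / (1 + r) * t))),
    COI.isClassKL_mul_exp_div hC0 (by positivity), fun t₀ w hw hbdd hM z₀ => ⟨?_, ?_⟩⟩
  · obtain ⟨K, hK⟩ := COI.System.exists_lipschitzWith_field (S := S) hsat hPmax
    have h := COI.exists_isSolution hK !₂[1 / (2 * S.HT), 0] hw
      (fun t ht => COI.abs_le_supAbs hbdd ht) z₀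
    have e : S.field sat = fun z w => S.field sat z 0 + w • !₂[1 / (2 * S.HT), 0] := by
      ext1 z; ext1 w; exact COI.System.field_eq z w
    rw [e]
    exact h
  · intro z hz _ t ht
    set M := COI.supAbs t₀ w
    have hM' : M ∈ Ico 0 (S.inputBound θ) := ⟨COI.supAbs_nonneg t₀ w, hM⟩
    set q := max (S.chiOne θ M) (S.chiTwo θ (S.chiOne θ) M)
    have hq0 : 0 ≤ q := le_max_of_le_right (Real.sqrt_nonneg _)
    set r := ‖z t₀‖
    have hr0 : 0 ≤ r := norm_nonneg _
    have hk1 : 0 < (1 - θ) * k / 2 / (1 + r) := by positivity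
    have hVc : ContinuousOn (fun t => S.energy (z t)) (Ici t₀) := by
      have h0 : ∀ i, ContinuousOn (fun t => z t i) (Ici t₀) := fun i =>
        (EuclideanSpace.proj (𝕜 := ℝ) i).continuous.comp_continuousOn hz.1
      exact (continuousOn_const.mul ((h0 0).pow 2)).add (continuousOn_const.mul ((h0 1).pow 2))
    have hV0 : 0 ≤ S.energy (z t₀) := le_trans (by positivity) (hV (z t₀)).1
    have hmain := le_max_mul_exp_of_hasDerivWithinAt (N := b * (√2 * q) ^ 2) hk1.le hVc hV0
      (fun s hs => by
        obtain ⟨l, hl, hzl⟩ := hz.exists_right_input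
          (COI.System.continuous_field hsat hPmax) hw
          (fun t ht => COI.abs_le_supAbs hbdd ht) hs
        refine ⟨_, COI.System.hasDerivWithinAt_energy hH.ne' hτ.ne' hzl, fun hN => ?_⟩
        have hlarge : 2 * q ^ 2 < ‖z s‖ ^ 2 := by
          refine lt_of_mul_lt_mul_left ?_ hb0.le
          calc b * (2 * q ^ 2) = b * (√2 * q) ^ 2 := by rw [mul_pow, Real.sq_sqrt (by norm_num)]
            _ < b * ‖z s‖ ^ 2 := hN.trans_le (hV (z s)).2
        have hxp : S.chiOne θ M ≤ |z s 0| ∨ M * S.dpgT / θ * S.chiOne θ M ≤ z s 1 ^ 2 := by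
          rw [EuclideanSpace.real_norm_sq_eq, Fin.sum_univ_two] at hlarge
          -- As the two squares sum to more than `2 q²`, one of them exceeds `q²`.
          rcases lt_or_ge (q ^ 2) (z s 0 ^ 2) with h | h
          · exact Or.inl ((le_max_left _ _).trans
              ((abs_of_nonneg hq0) ▸ (sq_lt_sq.1 h).le))
          · refine Or.inr ?_
            have h0 := COI.System.chiOne_nonneg hn hPmax hdpc hθ hM'
            have h1 : M * S.dpgT / θ * S.chiOne θ M = S.chiTwo θ (S.chiOne θ) M ^ 2 := by
              rw [COI.System.chiTwo, Real.sq_sqrt]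
              exact mul_nonneg (div_nonneg (mul_nonneg hM'.1 hdpgT.le) hθ.le) h0
            have h2 : S.chiTwo θ (S.chiOne θ) M ^ 2 ≤ q ^ 2 :=
              pow_le_pow_left₀ (Real.sqrt_nonneg _) (le_max_right _ _) 2
            linarith
        have hrate := COI.System.energy_rate_le hsat hn hPmax hdpc hdpgT hθ hM' hl hxp
        have hVs : 0 < S.energy (z s) := lt_of_le_of_lt (by positivity) hN
        have hrate' : ∀ ρ, 0 ≤ ρ → |z s 0| ≤ C * ρ →
            -z s 1 ^ 2 - S.dpgT * (z s 0 * S.gfcPower sat (z s 0) - z s 0 * l)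
              < -((1 - θ) * k / 2 / (1 + ρ) * S.energy (z s)) := fun ρ hρ h => by
          have h1 := mul_le_mul_of_nonneg_left (hk ρ hρ (z s) h) (sub_nonneg.2 hθ1.le)
          have h2 : 0 < (1 - θ) * k / 2 / (1 + ρ) * S.energy (z s) := by positivity
          have h3 : (1 - θ) * (k / (1 + ρ) * S.energy (z s))
              = 2 * ((1 - θ) * k / 2 / (1 + ρ) * S.energy (z s)) := by ring
          linarith
        have hcoord : |z s 0| ≤ ‖z s‖ := by
          simpa using PiLp.norm_apply_le (z s) 0
        -- The rate with the initial norm `r` needs the energy not to exceed its initial value; mere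
        -- decrease follows at any state by taking its own norm for `ρ`.
        refine ⟨?_, fun hle => hrate' r hr0 (hcoord.trans (hnorm _ _ hr0 ?_))⟩
        · have h1 := hrate' ‖z s‖ (norm_nonneg _)
            (hcoord.trans (hnorm _ _ (norm_nonneg _) (hV (z s)).2))
          have h2 : 0 < (1 - θ) * k / 2 / (1 + ‖z s‖) * S.energy (z s) := by positivity
          linarith
        · exact hle.trans (hV _).2) ht
    have hβ0 : 0 ≤ C * (r * Real.exp (-((1 - θ) * k / 4 / (1 + r) * (t - t₀)))) := by positivity
    have hγ0 : 0 ≤ C * √2 * q := by positivity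
    rcases le_max_iff.1 hmain with h | h
    · have h1 := hnorm (z t) (r * Real.exp (-((1 - θ) * k / 4 / (1 + r) * (t - t₀))))
        (by positivity) (h.trans ?_)
      · exact h1.trans (le_add_of_nonneg_right hγ0)
      · have h2 : Real.exp (-((1 - θ) * k / 2 / (1 + r) * (t - t₀)))
            = Real.exp (-((1 - θ) * k / 4 / (1 + r) * (t - t₀))) ^ 2 := by
          rw [← Real.exp_nat_mul]
          congr 1
          push_cast
          ring
        rw [h2, mul_pow, ← mul_assoc]
        gcongr
        exact (hV _).2
    · have h1 := hnorm (z t) (√2 * q) (by positivity) h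
      rw [← mul_assoc] at h1
      exact h1.trans (le_add_of_nonneg_left hβ0)
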